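/- For $0<q<1$ and $n\ge 1$ put $[n]_q=\frac{1-q^n}{1-q}$. The series $$\zeta_q(s)=\sum_{n=1}^{\infty}\frac{q^{n(s-1)}}{[n]_q^{\,s}}$$ converges absolutely for $\operatorname{Re}(s)>1$ and has a unique meromorphic continuation to all $s\in\mathbb{C}$, again denoted $\zeta_q(s)$ (with its limiting value at removable singularities). For every complex number $s\neq 1$, the function $\zeta_q$ has no pole at $s$ for all $q<1$ sufficiently close to $1$, and $$\lim_{q\uparrow 1}\zeta_q(s)=\zeta(s),$$ where $\zeta(s)$ is the Riemann zeta function, analytically continued to $\mathbb{C}\setminus\{1\}$. -/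

import Mathlib

open Filter Topology

noncomputable section

/-- The `q`-integer `[n]_q = (1 - q ^ n) / (1 - q)`, a positive real number for `0 < q < 1` and
`1 ≤ n`. -/
def qInt (q : ℝ) (n : ℕ) : ℝ := (1 - q ^ n) / (1 - q)

/-- The general term `q ^ (n (s - 1)) / [n]_q ^ s` of the defining series of the `q`-zeta function.
For `0 < q < 1` and `1 ≤ n` both complex powers have a positive real base, so that
`x ^ w = exp (w log x)` with the real logarithm of `x`. -/
def qZetaTerm (q : ℝ) (s : ℂ) (n : ℕ) : ℂ :=
  (q : ℂ) ^ ((n : ℂ) * (s - 1)) / (qInt q n : ℂ) ^ s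

/-- `F` is the meromorphic continuation to `ℂ` of `s ↦ ∑_{n ≥ 1} q ^ (n (s - 1)) / [n]_q ^ s`,
`1 < Re s`. The function `F` is required to be in normal form: it is analytic at each point that is
not a pole (so its value at a removable singularity is the limit there), and at the poles it takes
the conventional value `0`. -/
structure IsQZetaContinuation (q : ℝ) (F : ℂ → ℂ) : Prop where
  meromorphic : MeromorphicNFOn F Set.univ
  hasSum : ∀ s : ℂ, 1 < s.re → HasSum (fun n : ℕ => qZetaTerm q s (n + 1)) (F s)

/-- The `q`-zeta function `ζ_q` on `ℂ`: the meromorphic continuation of its defining series. -/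
def qZeta (q : ℝ) : ℂ → ℂ := Classical.epsilon (IsQZetaContinuation q)

end

/-! Expanding `(1 - q^n)^(-s)` in powers of `q^n` and summing over `n` first writes `ζ_q` as `(1 -
q)^s` times a series of fractions in `q^(s - 1 + r)`. Near any point all but finitely many of these
are holomorphic, so the series gives the continuation.

The limit cannot be taken fraction by fraction. Instead, with `a = -log q * (s - 1 + r)`, the
Bernoulli function `a e^(-a) / (1 - e^(-a))` is an average of `e^(-a z)` over the line `Re z = 1/2`
(`integral_exp_neg_mul_criticalParam`). On that line `|q^z| = √q < 1`, so the series can be summed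
under the integral: `-log q / (1 - q) * (s - 1) ζ_q(s)` becomes the average of `((1 - q) q^z / (1 -
q^z))^(s - 1)` (`integral_exp_mul_qLog`). This holds for `|Im s| < 2π / |log q|`, a strip that
eventually contains any given `s`.

As `q → 1` the base tends to `1 / z`, and `exists_norm_qLog_le` supplies a dominating function.
Hence `ζ_q(s)` converges for every `s ≠ 1`, to a limit holomorphic off `1`. For `Re s > 2` dominated
convergence of the defining series identifies the limit as `ζ(s)`; the identity theorem does the
rest. -/

/-! ### Binomial series with negative exponents -/

/-- The coefficient `s (s + 1) ⋯ (s + r - 1) / r!` of `x ^ r` in `(1 - x) ^ (-s)`. -/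
noncomputable def risingBinom (s : ℂ) (r : ℕ) : ℂ := ∏ k ∈ Finset.range r, (s + k) / (k + 1)

lemma risingBinom_succ (s : ℂ) (r : ℕ) :
    risingBinom s (r + 1) = risingBinom s r * ((s + r) / (r + 1)) :=
  Finset.prod_range_succ _ _

lemma risingBinom_eq_choose (s : ℂ) (r : ℕ) : risingBinom s r = Ring.choose (s + r - 1) r := by
  have h0 : (r.factorial : ℂ) ≠ 0 := by exact_mod_cast r.factorial_ne_zero
  have h1 : (r.factorial : ℂ) * Ring.choose (s + r - 1) r = (ascPochhammer ℂ r).eval s := by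
    rw [← nsmul_eq_mul, show s + (r : ℂ) - 1 = s + r - 1 from rfl, Ring.choose,
      show s + (r : ℂ) - 1 - r + 1 = s by ring, Ring.factorial_nsmul_multichoose_eq_ascPochhammer,
      Polynomial.ascPochhammer_smeval_eq_eval]
  have h2 : (r.factorial : ℂ) * risingBinom s r = (ascPochhammer ℂ r).eval s := by
    clear h0 h1
    induction r with
    | zero => simp [risingBinom]
    | succ r ih =>
      rw [risingBinom_succ, ascPochhammer_succ_right, Polynomial.eval_mul, ← ih,
        Nat.factorial_succ]
      have : (r : ℂ) + 1 ≠ 0 := by exact_mod_cast r.succ_ne_zero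
      simp only [Polynomial.eval_add, Polynomial.eval_X, Polynomial.eval_natCast]
      push_cast
      field_simp
  exact mul_left_cancel₀ h0 (h2.trans h1.symm)

/-- The binomial series for negative exponents. -/
lemma hasSum_risingBinom (s : ℂ) {x : ℂ} (hx : ‖x‖ < 1) :
    HasSum (fun r : ℕ => risingBinom s r * x ^ r) ((1 - x) ^ (-s)) := by
  have h := (Complex.one_div_one_sub_cpow_hasFPowerSeriesOnBall_zero s).hasSum
    (y := x) (by simpa [← enorm_eq_nnnorm, ← ofReal_norm] using hx)
  simpa [FormalMultilinearSeries.ofScalars, risingBinom_eq_choose, Complex.cpow_neg] using h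

/-- Gives a majorant uniform over a disc of `s`: the factors for `R` are nonnegative reals. -/
lemma norm_risingBinom_le {s : ℂ} {R : ℝ} (h : ‖s‖ ≤ R) (r : ℕ) :
    ‖risingBinom s r‖ ≤ ‖risingBinom (R : ℂ) r‖ := by
  have hR : 0 ≤ R := (norm_nonneg s).trans h
  simp only [risingBinom, norm_prod, norm_div]
  gcongr with k
  calc ‖s + k‖ ≤ ‖s‖ + ‖(k : ℂ)‖ := norm_add_le _ _
    _ ≤ R + k := by simpa using h
    _ = ‖(R : ℂ) + k‖ := by
      rw [← Complex.ofReal_natCast, ← Complex.ofReal_add, Complex.norm_real, Real.norm_of_nonneg]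
      positivity

lemma summable_norm_risingBinom (s : ℂ) {x : ℝ} (hx0 : 0 ≤ x) (hx : x < 1) :
    Summable (fun r : ℕ => ‖risingBinom s r‖ * x ^ r) := by
  have h := (hasSum_risingBinom s (x := (x : ℂ))
    (by simpa [abs_of_nonneg hx0] using hx)).summable.norm
  simpa [abs_of_nonneg hx0] using h

lemma differentiable_risingBinom (r : ℕ) : Differentiable ℂ (fun s => risingBinom s r) := by
  unfold risingBinom
  fun_prop

/-! ### Simple-fraction expansion; existence and uniqueness of the continuation -/

/-- The `r`-th term of the expansion of the `q`-zeta function into simple fractions in `q ^ s`. -/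
noncomputable def qZetaPart (q : ℝ) (r : ℕ) (s : ℂ) : ℂ :=
  risingBinom s r * ((q : ℂ) ^ (s - 1 + r) / (1 - (q : ℂ) ^ (s - 1 + r)))

/-- The expansion of the `q`-zeta function obtained by expanding `(1 - q ^ n) ^ (-s)` into powers of
`q ^ n` and summing over `n` first. -/
noncomputable def qZetaExpansion (q : ℝ) (s : ℂ) : ℂ :=
  ((1 - q : ℝ) : ℂ) ^ s * ∑' r : ℕ, qZetaPart q r s

section

variable {q : ℝ} (hq0 : 0 < q) (hq1 : q < 1)
include hq0

lemma differentiable_ofReal_cpow : Differentiable ℂ (fun s : ℂ => (q : ℂ) ^ s) := fun s =>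
  (differentiableAt_id (x := s)).const_cpow (Or.inl (by exact_mod_cast hq0.ne'))

lemma norm_ofReal_cpow (s : ℂ) : ‖(q : ℂ) ^ s‖ = q ^ s.re := Complex.norm_cpow_eq_rpow_re_of_pos hq0 s

include hq1

/-- Past index `N` the exponents have real part at least `1`, so the denominators stay at least `1 -
q` in norm and the binomial series at `x = q` is a majorant. -/
lemma norm_qZetaPart_tail_le {s : ℂ} {R : ℝ} (hs : ‖s‖ ≤ R) {N : ℕ} (hN : 2 ≤ s.re + N) (r : ℕ) :
    ‖qZetaPart q (r + N) s‖ ≤ ‖risingBinom (R : ℂ) (r + N)‖ * q ^ (r + N) * (q ^ N * (1 - q))⁻¹ := by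
  have hre : (s - 1 + ((r + N : ℕ) : ℂ)).re = s.re - 1 + (r + N) := by simp
  have h1 : ‖(q : ℂ) ^ (s - 1 + ((r + N : ℕ) : ℂ))‖ ≤ q ^ (r + 1) := by
    rw [norm_ofReal_cpow hq0, hre, ← Real.rpow_natCast]
    apply Real.rpow_le_rpow_of_exponent_ge hq0 hq1.le
    push_cast; linarith
  have h2 : 1 - q ≤ ‖1 - (q : ℂ) ^ (s - 1 + ((r + N : ℕ) : ℂ))‖ := by
    have := norm_sub_norm_le (1 : ℂ) ((q : ℂ) ^ (s - 1 + ((r + N : ℕ) : ℂ)))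
    have h3 : q ^ (r + 1) ≤ q := by
      simpa using pow_le_pow_of_le_one hq0.le hq1.le (Nat.le_add_left 1 r)
    rw [norm_one] at this
    linarith
  have h3 : 0 < 1 - q := sub_pos.2 hq1
  rw [qZetaPart, norm_mul, norm_div, mul_assoc]
  apply mul_le_mul (norm_risingBinom_le hs _) _ (by positivity) (norm_nonneg _)
  calc _ ≤ q ^ (r + 1) / (1 - q) := by gcongr
    _ ≤ q ^ r / (1 - q) := by
      gcongr ?_ / _
      exact pow_le_pow_of_le_one hq0.le hq1.le (Nat.le_succ r)
    _ = _ := by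
      rw [pow_add]; field_simp

lemma summable_qZetaPart_bound (R : ℝ) (N : ℕ) : Summable (fun r : ℕ =>
    ‖risingBinom (R : ℂ) (r + N)‖ * q ^ (r + N) * (q ^ N * (1 - q))⁻¹) :=
  ((summable_nat_add_iff N).2 (summable_norm_risingBinom (R : ℂ) hq0.le hq1)).mul_right _

lemma summable_qZetaPart (s : ℂ) : Summable (fun r => qZetaPart q r s) := by
  obtain ⟨N, hN⟩ := exists_nat_ge (2 - s.re)
  refine (summable_nat_add_iff N).1 (Summable.of_norm_bounded
    (summable_qZetaPart_bound hq0 hq1 ‖s‖ N)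
    (norm_qZetaPart_tail_le hq0 hq1 le_rfl (by linarith)))

omit hq0 hq1 in
lemma one_sub_cpow_ne_zero_of_re_pos (hq0 : 0 < q) (hq1 : q < 1) {a : ℂ} (ha : 0 < a.re) :
    1 - (q : ℂ) ^ a ≠ 0 := by
  intro h
  have h1 := congrArg norm (sub_eq_zero.1 h)
  rw [norm_ofReal_cpow hq0, norm_one] at h1
  exact (Real.rpow_lt_one hq0.le hq1 ha).ne h1.symm

/-- Only finitely many fractions can have a pole near `s₀`; the tail converges uniformly on the unit
ball. -/
lemma qZetaExpansion_eventuallyEq (s₀ : ℂ) : ∃ N : ℕ, ∃ T : ℂ → ℂ, AnalyticAt ℂ T s₀ ∧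
    ∀ s, qZetaExpansion q s =
      ((1 - q : ℝ) : ℂ) ^ s * ((∑ r ∈ Finset.range N, qZetaPart q r s) + T s) := by
  obtain ⟨N, hN⟩ := exists_nat_ge (3 - s₀.re)
  refine ⟨N, fun s => ∑' r : ℕ, qZetaPart q (r + N) s, ?_, fun s => ?_⟩
  · have hball : ∀ s ∈ Metric.ball s₀ 1, ‖s‖ ≤ ‖s₀‖ + 1 ∧ 2 ≤ s.re + N := by
      intro s hs
      rw [mem_ball_iff_norm] at hs
      have h1 := (Complex.abs_re_le_norm (s - s₀)).trans hs.le
      rw [Complex.sub_re, abs_le] at h1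
      have h2 := norm_le_norm_add_norm_sub' s s₀
      constructor <;> linarith
    refine DifferentiableOn.analyticAt (s := Metric.ball s₀ 1) ?_ (Metric.ball_mem_nhds _ one_pos)
    refine Complex.differentiableOn_tsum_of_summable_norm
      (summable_qZetaPart_bound hq0 hq1 (‖s₀‖ + 1) N) (fun r => ?_) Metric.isOpen_ball
      (fun r s hs => norm_qZetaPart_tail_le hq0 hq1 (hball s hs).1 (hball s hs).2 r)
    intro s hs
    have hp : DifferentiableAt ℂ (fun s : ℂ => (q : ℂ) ^ (s - 1 + ((r + N : ℕ) : ℂ))) s :=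
      (differentiable_ofReal_cpow hq0 _).comp s (by fun_prop)
    refine DifferentiableAt.differentiableWithinAt ?_
    refine (differentiable_risingBinom _ s).mul (hp.div (hp.const_sub 1) ?_)
    apply one_sub_cpow_ne_zero_of_re_pos hq0 hq1
    have := (hball s hs).2
    simp
    linarith [(Nat.cast_nonneg r : (0 : ℝ) ≤ r)]
  · rw [qZetaExpansion, (summable_qZetaPart hq0 hq1 s).sum_add_tsum_nat_add]

omit hq1 in
lemma analyticAt_ofReal_cpow_comp {f : ℂ → ℂ} {s : ℂ} (hf : AnalyticAt ℂ f s) :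
    AnalyticAt ℂ (fun s => (q : ℂ) ^ f s) s :=
  ((differentiable_ofReal_cpow hq0).analyticAt (f s)).comp hf

omit hq1 in
lemma meromorphicAt_qZetaPart (r : ℕ) (s : ℂ) : MeromorphicAt (qZetaPart q r) s := by
  have hp : AnalyticAt ℂ (fun s : ℂ => (q : ℂ) ^ (s - 1 + r)) s :=
    analyticAt_ofReal_cpow_comp hq0 (by fun_prop)
  exact ((differentiable_risingBinom r).analyticAt s).meromorphicAt.mul
    (hp.meromorphicAt.div (analyticAt_const.sub hp).meromorphicAt)

omit hq1 in
lemma analyticAt_qZetaPart {r : ℕ} {s : ℂ} (h : 1 - (q : ℂ) ^ (s - 1 + r) ≠ 0) :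
    AnalyticAt ℂ (qZetaPart q r) s := by
  have hp : AnalyticAt ℂ (fun s : ℂ => (q : ℂ) ^ (s - 1 + r)) s :=
    analyticAt_ofReal_cpow_comp hq0 (by fun_prop)
  exact ((differentiable_risingBinom r).analyticAt s).mul (hp.div (analyticAt_const.sub hp) h)

lemma meromorphicOn_qZetaExpansion : MeromorphicOn (qZetaExpansion q) Set.univ := by
  intro s _
  obtain ⟨N, T, hT, hN⟩ := qZetaExpansion_eventuallyEq hq0 hq1 s
  rw [funext hN]
  refine (analyticAt_ofReal_cpow_comp (sub_pos.2 hq1) analyticAt_id).meromorphicAt.mul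
    (MeromorphicAt.add ?_ hT.meromorphicAt)
  exact MeromorphicAt.fun_sum fun r _ => meromorphicAt_qZetaPart hq0 r s

lemma analyticAt_qZetaExpansion {s : ℂ} (hs : 1 < s.re) : AnalyticAt ℂ (qZetaExpansion q) s := by
  obtain ⟨N, T, hT, hN⟩ := qZetaExpansion_eventuallyEq hq0 hq1 s
  rw [funext hN]
  refine (analyticAt_ofReal_cpow_comp (sub_pos.2 hq1) analyticAt_id).mul (AnalyticAt.add ?_ hT)
  refine Finset.analyticAt_fun_sum _ fun r _ => analyticAt_qZetaPart hq0
    (one_sub_cpow_ne_zero_of_re_pos hq0 hq1 ?_)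
  simp
  linarith [(Nat.cast_nonneg r : (0 : ℝ) ≤ r)]

lemma qZetaTerm_succ_eq (s : ℂ) (n : ℕ) : HasSum
    (fun r : ℕ => ((1 - q : ℝ) : ℂ) ^ s * (risingBinom s r * ((q : ℂ) ^ (s - 1 + r)) ^ (n + 1)))
    (qZetaTerm q s (n + 1)) := by
  have hx : q ^ (n + 1) < 1 := pow_lt_one₀ hq0.le hq1 n.succ_ne_zero
  have hx0 : 0 < q ^ (n + 1) := by positivity
  have hqc : (q : ℂ) ≠ 0 := by exact_mod_cast hq0.ne'
  have h := hasSum_risingBinom s (x := ((q ^ (n + 1) : ℝ) : ℂ))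
    (by simpa [abs_of_pos hx0, abs_of_pos hq0] using hx)
  have h2 := h.mul_left (((1 - q : ℝ) : ℂ) ^ s * (q : ℂ) ^ (((n + 1 : ℕ) : ℂ) * (s - 1)))
  convert! h2 using 1
  · funext r
    rw [← Complex.cpow_nat_mul, mul_add, Complex.cpow_add _ _ hqc, Complex.ofReal_pow, ← pow_mul,
      ← Complex.cpow_natCast (q : ℂ) ((n + 1) * r)]
    push_cast
    ring
  · rw [qZetaTerm, qInt, div_eq_mul_inv (1 - q ^ (n + 1)), Complex.ofReal_mul,
      Complex.mul_cpow_ofReal_nonneg (by linarith) (by have := sub_pos.2 hq1; positivity),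
      Complex.ofReal_inv, Complex.inv_cpow, Complex.cpow_neg]
    · push_cast
      have h3 : ((1 : ℂ) - q) ^ s ≠ 0 := by
        rw [Ne, Complex.cpow_eq_zero_iff, not_and_or]
        left
        exact_mod_cast (sub_pos.2 hq1).ne'
      field_simp
    · rw [Complex.arg_ofReal_of_nonneg (by linarith)]
      exact Real.pi_pos.ne

/-- Fubini for an absolutely convergent double series: rows over `r` are binomial series, columns
over `n` geometric ones. -/
lemma hasSum_qZetaTerm {s : ℂ} (hs : 1 < s.re) :
    HasSum (fun n : ℕ => qZetaTerm q s (n + 1)) (qZetaExpansion q s) := by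
  set f : ℕ × ℕ → ℂ := fun p => ((1 - q : ℝ) : ℂ) ^ s *
    (risingBinom s p.2 * ((q : ℂ) ^ (s - 1 + p.2)) ^ (p.1 + 1)) with hf
  have hqs : q ^ (s.re - 1) < 1 := Real.rpow_lt_one hq0.le hq1 (by linarith)
  have hsum : Summable f := by
    apply Summable.mul_left
    have h1 : Summable (fun n : ℕ => (q ^ (s.re - 1)) ^ (n + 1)) :=
      (summable_nat_add_iff 1).2 (summable_geometric_of_lt_one (by positivity) hqs)
    have h2 := summable_norm_risingBinom s hq0.le hq1
    refine Summable.of_norm_bounded (h1.mul_of_nonneg h2 (fun n => by positivity)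
      (fun n => by positivity)) ?_
    rintro ⟨n, r⟩
    simp only [norm_mul, norm_pow]
    rw [norm_ofReal_cpow hq0, mul_comm, mul_comm ‖risingBinom s r‖, ← mul_assoc]
    gcongr
    rw [show (s - 1 + (r : ℂ)).re = s.re - 1 + r by simp, Real.rpow_add hq0, mul_pow]
    gcongr
    rw [Real.rpow_natCast]
    exact pow_le_of_le_one (by positivity) (pow_le_one₀ hq0.le hq1.le) n.succ_ne_zero
  have h1 : HasSum (fun n : ℕ => qZetaTerm q s (n + 1)) (∑' p, f p) :=
    hsum.hasSum.prod_fiberwise fun n => qZetaTerm_succ_eq hq0 hq1 s n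
  have h2 : HasSum (fun r : ℕ => ((1 - q : ℝ) : ℂ) ^ s * qZetaPart q r s) (∑' p, f p) := by
    refine HasSum.prod_fiberwise (f := fun p : ℕ × ℕ => f p.swap)
      ((Equiv.prodComm ℕ ℕ).hasSum_iff.2 hsum.hasSum) fun r => ?_
    have hlt : ‖(q : ℂ) ^ (s - 1 + r)‖ < 1 := by
      rw [norm_ofReal_cpow hq0]
      apply Real.rpow_lt_one hq0.le hq1
      simp
      linarith [(Nat.cast_nonneg r : (0 : ℝ) ≤ r)]
    have h3 := (((hasSum_geometric_of_norm_lt_one hlt).mul_right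
      ((q : ℂ) ^ (s - 1 + r))).mul_left (risingBinom s r)).mul_left (((1 - q : ℝ) : ℂ) ^ s)
    convert! h3 using 1
    rw [qZetaPart]
    ring
  rw [qZetaExpansion, ← tsum_mul_left, h2.tsum_eq]
  exact h1

lemma isQZetaContinuation_toMeromorphicNFOn :
    IsQZetaContinuation q (toMeromorphicNFOn (qZetaExpansion q) Set.univ) where
  meromorphic := meromorphicNFOn_toMeromorphicNFOn _ _
  hasSum s hs := by
    rw [toMeromorphicNFOn_eq_toMeromorphicNFAt (meromorphicOn_qZetaExpansion hq0 hq1)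
      (Set.mem_univ s),
      toMeromorphicNFAt_eq_self.2 (analyticAt_qZetaExpansion hq0 hq1 hs).meromorphicNFAt]
    exact hasSum_qZetaTerm hq0 hq1 hs

end

/-- The difference vanishes near `2`, so its order is `⊤` everywhere; normal form upgrades equality
on punctured neighbourhoods to equality at the centre. -/
lemma IsQZetaContinuation.unique {q : ℝ} {F G : ℂ → ℂ} (hF : IsQZetaContinuation q F)
    (hG : IsQZetaContinuation q G) : F = G := by
  have hm : Meromorphic (F - G) := meromorphicOn_univ.1
    (hF.meromorphic.meromorphicOn.sub hG.meromorphic.meromorphicOn)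
  have hev : ∀ᶠ s in 𝓝 (2 : ℂ), (F - G) s = 0 := by
    have h2 : ∀ᶠ s : ℂ in 𝓝 2, 1 < s.re :=
      Complex.continuous_re.continuousAt.eventually_const_lt (by simp)
    filter_upwards [h2] with s hs
    exact sub_eq_zero.2 ((hF.hasSum s hs).unique (hG.hasSum s hs))
  have htop : ∀ s, meromorphicOrderAt (F - G) s = ⊤ := by
    by_contra! h
    exact (hm.exists_meromorphicOrderAt_ne_top_iff_forall.1 h) 2
      (meromorphicOrderAt_eq_top_iff.2 (hev.filter_mono nhdsWithin_le_nhds))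
  funext s
  refine (((hF.meromorphic (Set.mem_univ s)).eventuallyEq_nhdsNE_iff_eventuallyEq_nhds
    (hG.meromorphic (Set.mem_univ s))).1 ?_).eq_of_nhds
  filter_upwards [meromorphicOrderAt_eq_top_iff.1 (htop s)] with w hw
  exact sub_eq_zero.1 hw

lemma qZeta_eq_toMeromorphicNFOn {q : ℝ} (hq0 : 0 < q) (hq1 : q < 1) :
    qZeta q = toMeromorphicNFOn (qZetaExpansion q) Set.univ :=
  (Classical.epsilon_spec (p := IsQZetaContinuation q)
    ⟨_, isQZetaContinuation_toMeromorphicNFOn hq0 hq1⟩).unique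
    (isQZetaContinuation_toMeromorphicNFOn hq0 hq1)

/-- If `ζ_q` is given by a function analytic at `s` on a punctured neighbourhood of `s`, then it
equals this function near `s`. -/
lemma qZeta_eventuallyEq {q : ℝ} (hq0 : 0 < q) (hq1 : q < 1) {s : ℂ} {G : ℂ → ℂ}
    (hG : AnalyticAt ℂ G s) (h : qZetaExpansion q =ᶠ[𝓝[≠] s] G) : qZeta q =ᶠ[𝓝 s] G := by
  rw [qZeta_eq_toMeromorphicNFOn hq0 hq1]
  refine (((meromorphicNFOn_toMeromorphicNFOn _ _
    (Set.mem_univ s)).eventuallyEq_nhdsNE_iff_eventuallyEq_nhds hG.meromorphicNFAt).1 ?_)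
  exact ((meromorphicOn_qZetaExpansion hq0 hq1).toMeromorphicNFOn_eq_self_on_nhdsNE
    (Set.mem_univ s)).trans h

/-! ### The critical line and its Laplace transform -/

/-- `log ((1 - u) / u)` on `(0, 1)`. -/
noncomputable def negLogit (u : ℝ) : ℝ := Real.log (1 - u) - Real.log u

/-- The parametrisation of the line `Re z = 1 / 2` by `(0, 1)` under which Lebesgue measure becomes
`π / (2 cosh² (π y)) dy`, where `z = 1 / 2 + i y`. -/
noncomputable def criticalParam (u : ℝ) : ℂ :=
  1 / 2 + Complex.I * ((negLogit u / (2 * Real.pi) : ℝ) : ℂ)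

@[simp] lemma criticalParam_re (u : ℝ) : (criticalParam u).re = 1 / 2 := by
  simp [criticalParam, -Complex.ofReal_div]

@[simp] lemma criticalParam_im (u : ℝ) : (criticalParam u).im = negLogit u / (2 * Real.pi) := by
  simp [criticalParam, -Complex.ofReal_div]

@[fun_prop] lemma measurable_negLogit : Measurable negLogit := by
  unfold negLogit; fun_prop

@[fun_prop] lemma measurable_criticalParam : Measurable criticalParam := by
  unfold criticalParam; fun_prop

lemma abs_criticalParam_im_le (u : ℝ) : |(criticalParam u).im| ≤ |negLogit u| := by
  rw [criticalParam_im, abs_div, abs_of_pos Real.two_pi_pos]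
  exact div_le_self (abs_nonneg _) (by linarith [Real.pi_gt_three])

section CriticalLine

open MeasureTheory Set

lemma exp_mul_negLogit (b : ℂ) {u : ℝ} (hu : u ∈ Ioo (0 : ℝ) 1) :
    Complex.exp (b * negLogit u) =
      (u : ℂ) ^ ((1 - b) - 1) * (1 - (u : ℂ)) ^ ((1 + b) - 1) := by
  have h1 : (u : ℂ) ≠ 0 := by exact_mod_cast hu.1.ne'
  have h2 : (1 - (u : ℂ)) ≠ 0 := by exact_mod_cast (sub_pos.2 hu.2).ne'
  rw [Complex.cpow_def_of_ne_zero h1, Complex.cpow_def_of_ne_zero h2, ← Complex.exp_add,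
    ← Complex.ofReal_one, ← Complex.ofReal_sub, ← Complex.ofReal_log hu.1.le,
    ← Complex.ofReal_log (sub_pos.2 hu.2).le, negLogit]
  congr 1
  push_cast
  ring

lemma integrableOn_exp_mul_negLogit {b : ℂ} (hb : |b.re| < 1) :
    IntegrableOn (fun u => Complex.exp (b * negLogit u)) (Ioo 0 1) := by
  rw [abs_lt] at hb
  have h := Complex.betaIntegral_convergent (u := 1 - b) (v := 1 + b)
    (by simp; linarith) (by simp; linarith)
  rw [intervalIntegrable_iff_integrableOn_Ioo_of_le zero_le_one] at h
  exact h.congr_fun (fun u hu => (exp_mul_negLogit b hu).symm) measurableSet_Ioo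

/-- The integral is `B(1 - b, 1 + b) = b Γ(b) Γ(1 - b)`, evaluated by the reflection formula. -/
lemma integral_exp_mul_negLogit {b : ℂ} (hb : |b.re| < 1) (hb0 : b ≠ 0) :
    ∫ u in Ioo (0 : ℝ) 1, Complex.exp (b * negLogit u) =
      Real.pi * b / Complex.sin (Real.pi * b) := by
  rw [abs_lt] at hb
  have h := Complex.Gamma_mul_Gamma_eq_betaIntegral (s := 1 - b) (t := 1 + b)
    (by simp; linarith) (by simp; linarith)
  rw [show 1 - b + (1 + b) = 1 + 1 by ring, Complex.Gamma_add_one _ one_ne_zero,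
    Complex.Gamma_one, one_mul, one_mul, add_comm 1 b, Complex.Gamma_add_one _ hb0,
    mul_left_comm, mul_comm (Complex.Gamma _), Complex.Gamma_mul_Gamma_one_sub,
    Complex.betaIntegral, intervalIntegral.integral_of_le zero_le_one,
    integral_Ioc_eq_integral_Ioo] at h
  rw [setIntegral_congr_fun measurableSet_Ioo fun u hu => exp_mul_negLogit b hu, add_comm 1 b, ← h]
  ring

lemma integrableOn_exp_mul_abs_negLogit {c : ℝ} (hc0 : 0 ≤ c) (hc : c < 1) :
    IntegrableOn (fun u => Real.exp (c * |negLogit u|)) (Ioo 0 1) := by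
  have h1 := (integrableOn_exp_mul_negLogit (b := c) (by simpa [abs_of_nonneg hc0] using hc)).norm
  have h2 := (integrableOn_exp_mul_negLogit (b := -c)
    (by simpa [abs_of_nonneg hc0] using hc)).norm
  refine (h1.add h2).mono' (by fun_prop) (ae_of_all _ fun u => ?_)
  simp only [Pi.add_apply, Complex.norm_exp, Real.norm_eq_abs, Real.abs_exp]
  rcases abs_cases (negLogit u) with ⟨h, -⟩ | ⟨h, -⟩ <;> rw [h]
  · simpa using (Real.exp_pos _).le
  · simpa using (Real.exp_pos _).le

lemma neg_mul_criticalParam (a : ℂ) (u : ℝ) : -a * criticalParam u =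
    -(a / 2) + (-Complex.I * a / (2 * Real.pi)) * negLogit u := by
  rw [criticalParam]
  push_cast
  ring

lemma abs_re_neg_I_mul_div_lt {a : ℂ} (ha : |a.im| < 2 * Real.pi) :
    |(-Complex.I * a / (2 * Real.pi)).re| < 1 := by
  have h : (-Complex.I * a / (2 * Real.pi)).re = a.im / (2 * Real.pi) := by
    rw [show (2 * Real.pi : ℂ) = ((2 * Real.pi : ℝ) : ℂ) by push_cast; rfl, Complex.div_ofReal_re]
    simp
  rw [h, abs_div, abs_of_pos Real.two_pi_pos, div_lt_one Real.two_pi_pos]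
  exact ha

lemma integrableOn_exp_neg_mul_criticalParam {a : ℂ} (ha : |a.im| < 2 * Real.pi) :
    IntegrableOn (fun u => Complex.exp (-a * criticalParam u)) (Ioo 0 1) := by
  simp_rw [neg_mul_criticalParam, Complex.exp_add]
  exact (integrableOn_exp_mul_negLogit (abs_re_neg_I_mul_div_lt ha)).const_mul _

/-- The Bernoulli generating function as the Laplace transform of `π / (2 cosh² (π y))` along the
line `Re z = 1 / 2`. -/
lemma integral_exp_neg_mul_criticalParam {a : ℂ} (ha : |a.im| < 2 * Real.pi) (ha0 : a ≠ 0) :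
    ∫ u in Ioo (0 : ℝ) 1, Complex.exp (-a * criticalParam u) =
      a * (Complex.exp (-a) / (1 - Complex.exp (-a))) := by
  have hpi : (Real.pi : ℂ) ≠ 0 := by exact_mod_cast Real.pi_ne_zero
  simp_rw [neg_mul_criticalParam, Complex.exp_add]
  rw [integral_const_mul, integral_exp_mul_negLogit (abs_re_neg_I_mul_div_lt ha)
    (by simp [ha0, hpi])]
  have h1 : (Real.pi : ℂ) * (-Complex.I * a / (2 * Real.pi)) = -(a / 2 * Complex.I) := by
    field_simp
  have h2 : Complex.exp (-a) = Complex.exp (-(a / 2)) * Complex.exp (-(a / 2)) := by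
    rw [← Complex.exp_add]; ring_nf
  have h3 : Complex.exp (a / 2) * Complex.exp (-(a / 2)) = 1 := by
    rw [← Complex.exp_add]; simp
  have hE : Complex.exp (-(a / 2)) ≠ 0 := Complex.exp_ne_zero _
  have h4 : Complex.exp (a / 2) = (Complex.exp (-(a / 2)))⁻¹ := eq_inv_of_mul_eq_one_left h3
  rw [h1, Complex.sin_neg, Complex.sin_mul_I, Complex.sinh, h2, h4]
  generalize Complex.exp (-(a / 2)) = E at *
  have hI := Complex.I_ne_zero
  have h5 : E⁻¹ - E = (1 - E * E) / E := by field_simp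
  rw [h5]
  -- Here both sides are `0` by division by zero, so `exp (-a) ≠ 1` need not be proved.
  by_cases hz : 1 - E * E = 0
  · simp [hz]
  · field_simp

/-! ### Integral representation of the `q`-zeta function -/

/-- The logarithm of `(1 - q) q ^ z / (1 - q ^ z)` at `z = criticalParam u`. -/
noncomputable def qLog (q : ℝ) (u : ℝ) : ℂ :=
  (Real.log q : ℂ) * criticalParam u -
    Complex.log ((1 - Complex.exp ((Real.log q : ℂ) * criticalParam u)) / ((1 - q : ℝ) : ℂ))

@[fun_prop] lemma measurable_qLog (q : ℝ) : Measurable (qLog q) := by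
  unfold qLog; fun_prop

section

variable {q : ℝ} (hq0 : 0 < q) (hq1 : q < 1)
include hq0

lemma norm_exp_log_mul_criticalParam (u : ℝ) :
    ‖Complex.exp ((Real.log q : ℂ) * criticalParam u)‖ = √q := by
  rw [Complex.norm_exp, Complex.re_ofReal_mul, criticalParam_re, Real.sqrt_eq_rpow,
    Real.rpow_def_of_pos hq0]

lemma cpow_eq_exp_log_mul (a : ℂ) : (q : ℂ) ^ a = Complex.exp ((Real.log q : ℂ) * a) := by
  rw [Complex.cpow_def_of_ne_zero (by exact_mod_cast hq0.ne'), Complex.ofReal_log hq0.le]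

include hq1

/-- The binomial series at `x = q^z`. Dividing by the positive real `1 - q` leaves the argument of
`1 - x` unchanged, so the principal branches match. -/
lemma hasSum_exp_mul_qLog (w : ℂ) (u : ℝ) : HasSum
    (fun r : ℕ => ((1 - q : ℝ) : ℂ) ^ w * risingBinom w r *
      Complex.exp (-(-(Real.log q : ℂ) * (w + r)) * criticalParam u))
    (Complex.exp (w * qLog q u)) := by
  have hx := norm_exp_log_mul_criticalParam hq0 u
  have hs : √q < 1 := (Real.sqrt_lt' one_pos).2 (by simpa using hq1)
  have h1q : 0 < 1 - q := sub_pos.2 hq1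
  set x := Complex.exp ((Real.log q : ℂ) * criticalParam u) with hxdef
  have hx1 : 1 - x ≠ 0 := by
    intro h
    rw [← sub_eq_zero.1 h, norm_one] at hx
    exact hs.ne hx.symm
  have h1qc : ((1 - q : ℝ) : ℂ) ≠ 0 := by exact_mod_cast h1q.ne'
  have h := ((hasSum_risingBinom w (x := x) (by rwa [hx])).mul_left
    (((1 - q : ℝ) : ℂ) ^ w * Complex.exp (w * ((Real.log q : ℂ) * criticalParam u))))
  convert! h using 1
  · funext r
    rw [show -(-(Real.log q : ℂ) * (w + r)) * criticalParam u =
      w * ((Real.log q : ℂ) * criticalParam u) + r * ((Real.log q : ℂ) * criticalParam u) by ring,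
      Complex.exp_add, Complex.exp_nat_mul]
    ring
  · rw [qLog, mul_sub, Complex.exp_sub, ← hxdef, div_eq_inv_mul (1 - x), ← Complex.ofReal_inv,
      Complex.log_ofReal_mul (inv_pos.2 h1q) hx1, mul_add, Complex.exp_add,
      Complex.cpow_def_of_ne_zero h1qc, Complex.cpow_def_of_ne_zero hx1,
      ← Complex.ofReal_log h1q.le, Real.log_inv, mul_comm (Complex.log _) (-w), neg_mul,
      Complex.exp_neg, Complex.ofReal_neg, mul_neg, Complex.exp_neg, mul_comm w (Real.log (1 - q) : ℂ)]
    field_simp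

omit hq0 hq1 in
-- Absorbs the factor `s - 1 + r` produced by the Laplace transform, turning coefficients for `s -
-- 1` into those for `s`.
lemma risingBinom_sub_one_mul (s : ℂ) (r : ℕ) :
    risingBinom (s - 1) r * (s - 1 + r) = (s - 1) * risingBinom s r := by
  induction r with
  | zero => simp [risingBinom]
  | succ r ih =>
    have : (r : ℂ) + 1 ≠ 0 := by exact_mod_cast r.succ_ne_zero
    rw [risingBinom_succ, risingBinom_succ, ← mul_assoc, ← ih]
    push_cast
    ring

/-- The integral representation of the `q`-zeta function in the strip `|Im s| < 2π / |log q|`. -/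
lemma integral_exp_mul_qLog {s : ℂ} (hs : |Real.log q| * |s.im| < 2 * Real.pi)
    (hr : ∀ r : ℕ, s - 1 + r ≠ 0) :
    ∫ u in Ioo (0 : ℝ) 1, Complex.exp ((s - 1) * qLog q u) =
      -(Real.log q : ℂ) / ((1 - q : ℝ) : ℂ) * ((s - 1) * qZetaExpansion q s) := by
  have h1q : 0 < 1 - q := sub_pos.2 hq1
  have h1qc : ((1 - q : ℝ) : ℂ) ≠ 0 := by exact_mod_cast h1q.ne'
  have hlog : Real.log q ≠ 0 := (Real.log_neg hq0 hq1).ne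
  have hlogc : (Real.log q : ℂ) ≠ 0 := by exact_mod_cast hlog
  have him : ∀ r : ℕ, (-(Real.log q : ℂ) * (s - 1 + r)).im = -Real.log q * s.im := by
    intro r; simp
  have him2 : ∀ r : ℕ, |(-(Real.log q : ℂ) * (s - 1 + r)).im| < 2 * Real.pi := by
    intro r; rw [him, abs_mul, abs_neg]; exact hs
  set F : ℕ → ℝ → ℂ := fun r u => ((1 - q : ℝ) : ℂ) ^ (s - 1) * risingBinom (s - 1) r *
      Complex.exp (-(-(Real.log q : ℂ) * (s - 1 + r)) * criticalParam u) with hF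
  have hFint : ∀ r, IntegrableOn (F r) (Ioo 0 1) := fun r =>
    (integrableOn_exp_neg_mul_criticalParam (him2 r)).const_mul _
  -- Since `|q^z| = √q` on the whole line, the dependence on `r` splits off as a scalar, and one
  -- summable series justifies the interchange.
  have hnorm : ∀ r u, ‖F r u‖ = (‖risingBinom (s - 1) r‖ * √q ^ r) *
      ‖((1 - q : ℝ) : ℂ) ^ (s - 1) *
        Complex.exp (-(-(Real.log q : ℂ) * (s - 1)) * criticalParam u)‖ := by
    intro r u
    rw [hF]
    simp only
    rw [show -(-(Real.log q : ℂ) * (s - 1 + r)) * criticalParam u =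
      -(-(Real.log q : ℂ) * (s - 1)) * criticalParam u +
        r * ((Real.log q : ℂ) * criticalParam u) by ring, Complex.exp_add, Complex.exp_nat_mul]
    simp only [norm_mul, norm_pow]
    rw [norm_exp_log_mul_criticalParam hq0]
    ring
  have hsum := hasSum_integral_of_summable_integral_norm hFint (by
    simp_rw [hnorm, integral_const_mul]
    exact (summable_norm_risingBinom (s - 1) (Real.sqrt_nonneg q)
      ((Real.sqrt_lt' one_pos).2 (by simpa using hq1))).mul_right _)
  simp_rw [hF, (hasSum_exp_mul_qLog hq0 hq1 (s - 1) _).tsum_eq] at hsum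
  rw [← hsum.tsum_eq, qZetaExpansion, ← mul_assoc (s - 1), ← mul_assoc, ← tsum_mul_left]
  congr 1
  funext r
  rw [integral_const_mul, integral_exp_neg_mul_criticalParam (him2 r)
    (mul_ne_zero (neg_ne_zero.2 hlogc) (hr r)), qZetaPart, cpow_eq_exp_log_mul hq0,
    Complex.cpow_sub _ _ h1qc, Complex.cpow_one, ← neg_mul, neg_neg]
  linear_combination (-(Real.log q : ℂ) / ((1 - q : ℝ) : ℂ)) * ((1 - q : ℝ) : ℂ) ^ s *
    (Complex.exp ((Real.log q : ℂ) * (s - 1 + r)) /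
      (1 - Complex.exp ((Real.log q : ℂ) * (s - 1 + r)))) * risingBinom_sub_one_mul s r

end

/-! ### Uniform bounds and the limit `q → 1` -/

/-- A family of exponentials with logarithmic growth rate at most `δ` depends holomorphically on the
parameter. -/
lemma differentiableAt_integral_exp_mul {L : ℝ → ℂ} (hL : Measurable L) {C δ R : ℝ}
    (hδ : 0 ≤ δ) (hR : 0 ≤ R) (hδR : δ * (R + 1) < 1)
    (hb : ∀ u ∈ Ioo (0 : ℝ) 1, ‖L u‖ ≤ C + δ * |negLogit u|) {s₀ : ℂ} (hs₀ : ‖s₀ - 1‖ < R) :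
    DifferentiableAt ℂ (fun s : ℂ => ∫ u in Ioo (0 : ℝ) 1, Complex.exp ((s - 1) * L u)) s₀ := by
  have hbi : IntegrableOn (fun u => Real.exp (C * (R + 1)) * Real.exp (δ * (R + 1) * |negLogit u|))
      (Ioo 0 1) :=
    (integrableOn_exp_mul_abs_negLogit (by positivity) hδR).const_mul _
  -- The extra `1` in `R + 1` pays for the factor `L u` of the derivative, via `‖L u‖ ≤ exp ‖L u‖`.
  have hexp : ∀ s : ℂ, ‖s - 1‖ < R → ∀ u ∈ Ioo (0 : ℝ) 1,
      ‖L u * Complex.exp ((s - 1) * L u)‖ ≤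
        Real.exp (C * (R + 1)) * Real.exp (δ * (R + 1) * |negLogit u|) ∧
      ‖Complex.exp ((s - 1) * L u)‖ ≤
        Real.exp (C * (R + 1)) * Real.exp (δ * (R + 1) * |negLogit u|) := by
    intro s hs u hu
    have h1 : ‖Complex.exp ((s - 1) * L u)‖ ≤ Real.exp (R * ‖L u‖) := by
      refine (Complex.norm_exp_le_exp_norm _).trans (Real.exp_le_exp.2 ?_)
      rw [norm_mul]
      gcongr
    have h2 : ‖L u‖ ≤ Real.exp ‖L u‖ := by linarith [Real.add_one_le_exp ‖L u‖]
    have h3 : Real.exp ((R + 1) * ‖L u‖) ≤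
        Real.exp (C * (R + 1)) * Real.exp (δ * (R + 1) * |negLogit u|) := by
      rw [← Real.exp_add]
      apply Real.exp_le_exp.2
      nlinarith [mul_le_mul_of_nonneg_left (hb u hu) (by linarith : (0 : ℝ) ≤ R + 1)]
    constructor
    · rw [norm_mul]
      calc _ ≤ Real.exp ‖L u‖ * Real.exp (R * ‖L u‖) := by gcongr
        _ = Real.exp ((R + 1) * ‖L u‖) := by rw [← Real.exp_add]; ring_nf
        _ ≤ _ := h3
    · refine h1.trans (le_trans (Real.exp_le_exp.2 ?_) h3)
      nlinarith [norm_nonneg (L u)]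
  have hopen : {s : ℂ | ‖s - 1‖ < R} ∈ 𝓝 s₀ :=
    (isOpen_lt (by fun_prop) continuous_const).mem_nhds hs₀
  refine (hasDerivAt_integral_of_dominated_loc_of_deriv_le (μ := volume.restrict (Ioo (0 : ℝ) 1))
    (F := fun s u => Complex.exp ((s - 1) * L u))
    (F' := fun s u => L u * Complex.exp ((s - 1) * L u)) hopen
    (Eventually.of_forall fun s => by fun_prop) ?_ (by fun_prop) ?_ hbi ?_).2.differentiableAt
  · refine hbi.mono' (by fun_prop) ?_
    exact (ae_restrict_mem measurableSet_Ioo).mono fun u hu => (hexp s₀ hs₀ u hu).2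
  · exact (ae_restrict_mem measurableSet_Ioo).mono fun u hu s hs => (hexp s hs u hu).1
  · refine ae_of_all _ fun u s _ => ?_
    have := (((hasDerivAt_id s).sub_const 1).mul_const (L u)).cexp
    simpa [mul_comm] using this

lemma integrableOn_bound {C δ R : ℝ} (hδ : 0 ≤ δ) (hR : 0 ≤ R) (hδR : δ * (R + 1) < 1) :
    IntegrableOn (fun u => Real.exp (R * (C + δ * |negLogit u|))) (Ioo 0 1) := by
  have h : IntegrableOn (fun u => Real.exp (R * C) * Real.exp (δ * R * |negLogit u|)) (Ioo 0 1) :=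
    (integrableOn_exp_mul_abs_negLogit (by positivity) (by nlinarith)).const_mul _
  refine h.congr_fun (fun u _ => ?_) measurableSet_Ioo
  simp only
  rw [← Real.exp_add]
  ring_nf

lemma norm_exp_mul_le {s L : ℂ} {R B : ℝ} (hs : ‖s - 1‖ ≤ R) (hL : ‖L‖ ≤ B) :
    ‖Complex.exp ((s - 1) * L)‖ ≤ Real.exp (R * B) := by
  refine (Complex.norm_exp_le_exp_norm _).trans (Real.exp_le_exp.2 ?_)
  rw [norm_mul]
  have := (norm_nonneg _).trans hs
  gcongr

lemma norm_one_sub_exp_le {w : ℂ} (hw : w.re ≤ 0) : ‖1 - Complex.exp w‖ ≤ 2 * ‖w‖ := by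
  rcases le_total ‖w‖ 1 with h | h
  · rw [norm_sub_rev]; exact Complex.norm_exp_sub_one_le h
  · refine (norm_sub_le _ _).trans ?_
    rw [Complex.norm_exp, norm_one]
    have := Real.exp_le_one_iff.2 hw
    linarith

/-- Apply `log x ≤ x - 1` to `x = δ * ‖W‖`: the growth rate is arbitrarily small at the cost of a
constant. -/
lemma norm_log_le {W : ℂ} {δ : ℝ} (hδ : 0 < δ) (hW : 1 / 2 ≤ ‖W‖) :
    ‖Complex.log W‖ ≤ δ * ‖W‖ + |Real.log δ| + Real.log 2 + Real.pi := by
  have hpos : 0 < ‖W‖ := by linarith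
  have h1 : ‖Complex.log W‖ ≤ |Real.log ‖W‖| + Real.pi := by
    refine (Complex.norm_le_abs_re_add_abs_im _).trans ?_
    rw [Complex.log_re, Complex.log_im]
    gcongr
    exact Complex.abs_arg_le_pi W
  have h2 : |Real.log ‖W‖| ≤ δ * ‖W‖ + |Real.log δ| + Real.log 2 := by
    have hl2 : 0 < Real.log 2 := Real.log_pos one_lt_two
    rw [abs_le]
    constructor
    · have := Real.log_le_log (by norm_num) hW
      rw [one_div, Real.log_inv] at this
      have h3 : 0 ≤ δ * ‖W‖ + |Real.log δ| := by positivity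
      linarith
    · have h3 := Real.log_le_sub_one_of_pos (mul_pos hδ hpos)
      rw [Real.log_mul hδ.ne' hpos.ne'] at h3
      linarith [neg_abs_le (Real.log δ)]
  linarith

/-- The logarithms `qLog q` grow slowly, uniformly for `q` close to `1`. -/
lemma exists_norm_qLog_le {δ : ℝ} (hδ : 0 < δ) : ∃ C : ℝ, 0 ≤ C ∧
    ∀ᶠ q : ℝ in 𝓝[<] 1, ∀ u : ℝ, ‖qLog q u‖ ≤ C + δ * |negLogit u| := by
  have hl2 : 0 < Real.log 2 := Real.log_pos one_lt_two
  -- The logarithm's argument is at most `4 * ‖z‖`, so `δ / 8` costs `δ / 2 * ‖z‖`; the term `log q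
  -- * z` costs the other half.
  refine ⟨|Real.log (δ / 8)| + Real.log 2 + Real.pi + δ, by positivity, ?_⟩
  have e1 : ∀ᶠ q : ℝ in 𝓝[<] 1, 1 / 2 < q :=
    (lt_mem_nhds (by norm_num)).filter_mono nhdsWithin_le_nhds
  have e2 : ∀ᶠ q : ℝ in 𝓝[<] 1, |Real.log q| < δ / 2 := by
    have : ContinuousAt (fun q : ℝ => |Real.log q|) 1 :=
      (Real.continuousAt_log one_ne_zero).abs
    refine (this.eventually_lt_const ?_).filter_mono nhdsWithin_le_nhds
    simpa using hδ
  filter_upwards [e1, e2, self_mem_nhdsWithin] with q hq hlogδ hq1 u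
  rw [mem_Iio] at hq1
  have hq0 : 0 < q := by linarith
  have h1q : 0 < 1 - q := sub_pos.2 hq1
  have hneg := Real.log_neg hq0 hq1
  have hlogle : |Real.log q| ≤ 2 * (1 - q) := by
    rw [abs_of_neg hneg]
    have h := Real.one_sub_inv_le_log_of_pos hq0
    have h2 : q⁻¹ - 1 ≤ 2 * (1 - q) := by
      rw [inv_eq_one_div, div_sub_one hq0.ne', div_le_iff₀ hq0]
      nlinarith
    linarith
  set w : ℂ := (Real.log q : ℂ) * criticalParam u with hw
  have hwre : w.re ≤ 0 := by
    rw [hw, Complex.re_ofReal_mul, criticalParam_re]; linarith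
  have hwn : ‖w‖ = |Real.log q| * ‖criticalParam u‖ := by
    rw [hw, norm_mul, Complex.norm_real, Real.norm_eq_abs]
  have hzn : ‖criticalParam u‖ ≤ 1 / 2 + |negLogit u| := by
    refine (Complex.norm_le_abs_re_add_abs_im _).trans ?_
    rw [criticalParam_re, abs_of_pos (by norm_num : (0 : ℝ) < 1 / 2)]
    exact add_le_add_right (abs_criticalParam_im_le u) _
  have hWn : ‖(1 - Complex.exp w) / ((1 - q : ℝ) : ℂ)‖ = ‖1 - Complex.exp w‖ / (1 - q) := by
    rw [norm_div, Complex.norm_real, Real.norm_of_nonneg h1q.le]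
  have hWup : ‖(1 - Complex.exp w) / ((1 - q : ℝ) : ℂ)‖ ≤ 4 * ‖criticalParam u‖ := by
    rw [hWn, div_le_iff₀ h1q]
    refine (norm_one_sub_exp_le hwre).trans ?_
    rw [hwn]
    nlinarith [mul_le_mul_of_nonneg_right hlogle (norm_nonneg (criticalParam u))]
  -- Uses `1 - √q ≥ (1 - q) / 2`, that is `(1 - √q)² ≥ 0`.
  have hWlo : 1 / 2 ≤ ‖(1 - Complex.exp w) / ((1 - q : ℝ) : ℂ)‖ := by
    rw [hWn, le_div_iff₀ h1q]
    have h := norm_sub_norm_le (1 : ℂ) (Complex.exp w)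
    rw [norm_one, norm_exp_log_mul_criticalParam hq0 u] at h
    nlinarith [Real.sq_sqrt hq0.le, Real.sqrt_nonneg q, sq_nonneg (√q - 1)]
  have hmain := norm_log_le (by positivity : 0 < δ / 8) hWlo
  have hfin : ‖qLog q u‖ ≤ ‖w‖ + ‖Complex.log ((1 - Complex.exp w) / ((1 - q : ℝ) : ℂ))‖ :=
    norm_sub_le _ _
  have h5 : ‖w‖ ≤ δ / 2 * ‖criticalParam u‖ := by
    rw [hwn]; gcongr
  have h6 : δ / 8 * ‖(1 - Complex.exp w) / ((1 - q : ℝ) : ℂ)‖ ≤ δ / 2 * ‖criticalParam u‖ := by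
    nlinarith
  have h7 : δ * ‖criticalParam u‖ ≤ δ * (1 / 2 + |negLogit u|) := by gcongr
  linarith

/-- The derivative of `q^z` at `q = 1` is `z`, and `Re z = 1/2` keeps `z` off the branch cut. -/
lemma tendsto_qLog (u : ℝ) :
    Tendsto (fun q : ℝ => qLog q u) (𝓝[<] 1) (𝓝 (-Complex.log (criticalParam u))) := by
  have hlog : Tendsto (fun q : ℝ => (Real.log q : ℂ) * criticalParam u) (𝓝[<] 1) (𝓝 0) := by
    have h : ContinuousAt (fun q : ℝ => (Real.log q : ℂ) * criticalParam u) 1 :=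
      (Complex.continuous_ofReal.continuousAt.comp
        (Real.continuousAt_log one_ne_zero)).mul continuousAt_const
    simpa [ContinuousAt] using h.tendsto.mono_left nhdsWithin_le_nhds
  have hd : HasDerivAt (fun q : ℝ => Complex.exp ((Real.log q : ℂ) * criticalParam u))
      (criticalParam u) 1 := by
    have h := (((Real.hasDerivAt_log one_ne_zero).ofReal_comp).mul_const (criticalParam u)).cexp
    simpa using h
  have hs : Tendsto (fun q : ℝ => (1 - Complex.exp ((Real.log q : ℂ) * criticalParam u)) /
      ((1 - q : ℝ) : ℂ)) (𝓝[<] 1) (𝓝 (criticalParam u)) := by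
    have h := (hasDerivAt_iff_tendsto_slope.1 hd).mono_left
      (nhdsWithin_mono (1 : ℝ) (fun q (hq : q < 1) => hq.ne))
    refine h.congr fun q => ?_
    rw [slope, vsub_eq_sub]
    simp only [Real.log_one, Complex.ofReal_zero, zero_mul, Complex.exp_zero, Complex.real_smul]
    rw [← neg_sub 1 q, ← neg_sub 1 (Complex.exp _), inv_neg]
    push_cast
    ring
  have hc := (continuousAt_clog (x := criticalParam u)
    (Or.inl (by rw [criticalParam_re]; norm_num))).tendsto.comp hs
  simpa [qLog, Function.comp_def] using hlog.sub hc

/-- `s ↦ (s - 1) ζ(s)` as an integral over the critical line. -/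
noncomputable def criticalIntegral (s : ℂ) : ℂ :=
  ∫ u in Ioo (0 : ℝ) 1, Complex.exp ((s - 1) * -Complex.log (criticalParam u))

lemma differentiable_criticalIntegral : Differentiable ℂ criticalIntegral := by
  intro s
  set R := ‖s - 1‖ + 1 with hR
  have hR0 : 0 < R := by positivity
  -- This `δ` makes `δ * (R + 1) = 1/2`; the bound passes to the limit `-log z`.
  obtain ⟨C, hC, h⟩ := exists_norm_qLog_le (δ := 1 / (2 * (R + 1))) (by positivity)
  refine differentiableAt_integral_exp_mul (by fun_prop) (by positivity) hR0.le ?_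
    (fun u _ => le_of_tendsto (tendsto_qLog u).norm (h.mono fun q hq => hq u)) (by linarith)
  field_simp
  norm_num

lemma tendsto_integral_exp_mul_qLog (s : ℂ) :
    Tendsto (fun q : ℝ => ∫ u in Ioo (0 : ℝ) 1, Complex.exp ((s - 1) * qLog q u)) (𝓝[<] 1)
      (𝓝 (criticalIntegral s)) := by
  have hR := norm_nonneg (s - 1)
  obtain ⟨C, hC, h⟩ := exists_norm_qLog_le (δ := 1 / (2 * (‖s - 1‖ + 1))) (by positivity)
  refine tendsto_integral_filter_of_dominated_convergence _
    (Eventually.of_forall fun q => by fun_prop)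
    (h.mono fun q hq => ae_of_all _ fun u => norm_exp_mul_le le_rfl (hq u))
    (integrableOn_bound (by positivity) hR ?_)
    (ae_of_all _ fun u => ((tendsto_qLog u).const_mul (s - 1)).cexp)
  field_simp
  norm_num

lemma eventually_analyticAt_integral_exp_mul_qLog (s : ℂ) : ∀ᶠ q : ℝ in 𝓝[<] 1,
    AnalyticAt ℂ (fun s : ℂ => ∫ u in Ioo (0 : ℝ) 1, Complex.exp ((s - 1) * qLog q u)) s := by
  set R := ‖s - 1‖ + 1 with hR
  have hR0 : 0 < R := by positivity
  obtain ⟨C, hC, h⟩ := exists_norm_qLog_le (δ := 1 / (2 * (R + 1))) (by positivity)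
  filter_upwards [h] with q hq
  have hopen : {w : ℂ | ‖w - 1‖ < R} ∈ 𝓝 s :=
    (isOpen_lt (by fun_prop) continuous_const).mem_nhds (by simp [hR])
  refine DifferentiableOn.analyticAt (s := {w : ℂ | ‖w - 1‖ < R}) (fun w hw => ?_) hopen
  refine (differentiableAt_integral_exp_mul (measurable_qLog q) (by positivity) hR0.le ?_
    (fun u _ => hq u) hw).differentiableWithinAt
  field_simp
  norm_num

/-- The Laplace formula needs `a ≠ 0`; the excluded points `1 - r` are isolated, so a punctured
neighbourhood avoids them. -/
lemma eventually_sub_one_add_ne_zero (s₀ : ℂ) : ∀ᶠ s : ℂ in 𝓝[≠] s₀, ∀ r : ℕ, s - 1 + r ≠ 0 := by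
  obtain ⟨N, hN⟩ := exists_nat_ge (2 - s₀.re)
  have h1 : ∀ᶠ s : ℂ in 𝓝[≠] s₀, ∀ r ∈ Finset.range N, s - 1 + r ≠ 0 := by
    rw [Filter.eventually_all_finset]
    intro r _
    by_cases h : s₀ - 1 + r = 0
    · filter_upwards [self_mem_nhdsWithin] with s hs h'
      exact hs (show s = s₀ by linear_combination h' - h)
    · have : ContinuousAt (fun s : ℂ => s - 1 + r) s₀ := by fun_prop
      exact (this.eventually_ne h).filter_mono nhdsWithin_le_nhds
  have h2 : ∀ᶠ s : ℂ in 𝓝[≠] s₀, s₀.re - 1 < s.re :=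
    (Complex.continuous_re.continuousAt.eventually_const_lt (by linarith)).filter_mono
      nhdsWithin_le_nhds
  filter_upwards [h1, h2] with s hs1 hs2 r h
  by_cases hr : r < N
  · exact hs1 r (Finset.mem_range.2 hr) h
  · have h3 := congrArg Complex.re h
    simp only [Complex.add_re, Complex.sub_re, Complex.one_re, Complex.natCast_re,
      Complex.zero_re] at h3
    have : (N : ℝ) ≤ r := by exact_mod_cast not_lt.1 hr
    linarith

lemma eventually_qZeta_eventuallyEq {s : ℂ} (hs : s ≠ 1) : ∀ᶠ q : ℝ in 𝓝[<] 1,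
    AnalyticAt ℂ (qZeta q) s ∧ qZeta q s =
      (-(Real.log q : ℂ) / ((1 - q : ℝ) : ℂ))⁻¹ *
        ((∫ u in Ioo (0 : ℝ) 1, Complex.exp ((s - 1) * qLog q u)) / (s - 1)) := by
  have e1 : ∀ᶠ q : ℝ in 𝓝[<] 1, 0 < q := (lt_mem_nhds one_pos).filter_mono nhdsWithin_le_nhds
  have e2 : ∀ᶠ q : ℝ in 𝓝[<] 1, |Real.log q| * |s.im| < 2 * Real.pi := by
    have : ContinuousAt (fun q : ℝ => |Real.log q| * |s.im|) 1 :=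
      (Real.continuousAt_log one_ne_zero).abs.mul continuousAt_const
    refine (this.eventually_lt_const ?_).filter_mono nhdsWithin_le_nhds
    simpa using Real.pi_pos
  filter_upwards [e1, e2, self_mem_nhdsWithin, eventually_analyticAt_integral_exp_mul_qLog s]
    with q hq0 him hq1 hA
  rw [mem_Iio] at hq1
  have h1qc : ((1 - q : ℝ) : ℂ) ≠ 0 := by exact_mod_cast (sub_pos.2 hq1).ne'
  have hlogc : (Real.log q : ℂ) ≠ 0 := by exact_mod_cast (Real.log_neg hq0 hq1).ne
  have hG : AnalyticAt ℂ (fun s => (-(Real.log q : ℂ) / ((1 - q : ℝ) : ℂ))⁻¹ *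
        ((∫ u in Ioo (0 : ℝ) 1, Complex.exp ((s - 1) * qLog q u)) / (s - 1))) s :=
    analyticAt_const.mul (hA.div (by fun_prop) (sub_ne_zero.2 hs))
  have heq := qZeta_eventuallyEq hq0 hq1 hG (by
    have e3 : ∀ᶠ w in 𝓝[≠] s, w ≠ 1 := (eventually_ne_nhds hs).filter_mono nhdsWithin_le_nhds
    have e4 : ∀ᶠ w : ℂ in 𝓝[≠] s, |Real.log q| * |w.im| < 2 * Real.pi := by
      have : ContinuousAt (fun w : ℂ => |Real.log q| * |w.im|) s := by fun_prop
      exact (this.eventually_lt_const him).filter_mono nhdsWithin_le_nhds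
    filter_upwards [e3, e4, eventually_sub_one_add_ne_zero s] with w hw1 hw2 hw3
    have hw1' := sub_ne_zero.2 hw1
    rw [integral_exp_mul_qLog hq0 hq1 hw2 hw3]
    field_simp)
  exact ⟨hG.congr heq.symm, heq.eq_of_nhds⟩

lemma tendsto_qZeta_criticalIntegral {s : ℂ} (hs : s ≠ 1) :
    Tendsto (fun q : ℝ => qZeta q s) (𝓝[<] 1) (𝓝 (criticalIntegral s / (s - 1))) := by
  have h1 : Tendsto (fun q : ℝ => -(Real.log q : ℂ) / ((1 - q : ℝ) : ℂ)) (𝓝[<] 1) (𝓝 1) := by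
    have h := (hasDerivAt_iff_tendsto_slope.1 (Real.hasDerivAt_log one_ne_zero)).mono_left
      (nhdsWithin_mono (1 : ℝ) (fun q (hq : q < 1) => hq.ne))
    have h2 := (Complex.continuous_ofReal.tendsto _).comp h
    rw [inv_one, Complex.ofReal_one] at h2
    refine h2.congr fun q => ?_
    rw [Function.comp_apply, slope, vsub_eq_sub, ← neg_sub 1 q]
    simp only [Real.log_one, sub_zero, smul_eq_mul]
    push_cast
    rw [inv_neg]
    ring
  have h2 := (h1.inv₀ one_ne_zero).mul ((tendsto_integral_exp_mul_qLog s).div_const (s - 1))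
  rw [inv_one, one_mul] at h2
  exact h2.congr' ((eventually_qZeta_eventuallyEq hs).mono fun q hq => hq.2.symm)

/-! ### The limit for `Re s > 2` and the identity theorem -/

lemma tendsto_qInt (n : ℕ) : Tendsto (fun q : ℝ => qInt q n) (𝓝[<] 1) (𝓝 n) := by
  have hd : HasDerivAt (fun q : ℝ => q ^ n) n 1 := by simpa using hasDerivAt_pow n (1 : ℝ)
  have h := (hasDerivAt_iff_tendsto_slope.1 hd).mono_left
    (nhdsWithin_mono (1 : ℝ) (fun q (hq : q < 1) => hq.ne))
  refine h.congr fun q => ?_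
  rw [slope_def_field, qInt, one_pow, ← neg_sub 1 q, ← neg_sub 1 (q ^ n), neg_div_neg_eq]

lemma qInt_eq_sum {q : ℝ} (hq : q < 1) (n : ℕ) : qInt q n = ∑ k ∈ Finset.range n, q ^ k := by
  rw [qInt, ← mul_neg_geom_sum, mul_div_cancel_left₀ _ (sub_pos.2 hq).ne']

lemma mul_pow_le_qInt {q : ℝ} (hq0 : 0 < q) (hq1 : q < 1) (n : ℕ) : n * q ^ n ≤ qInt q n := by
  rw [qInt_eq_sum hq1]
  calc (n : ℝ) * q ^ n = ∑ _k ∈ Finset.range n, q ^ n := by simp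
    _ ≤ _ := Finset.sum_le_sum fun k hk =>
      pow_le_pow_of_le_one hq0.le hq1.le (Finset.mem_range.1 hk).le

lemma one_le_qInt_succ {q : ℝ} (hq0 : 0 < q) (hq1 : q < 1) (n : ℕ) : 1 ≤ qInt q (n + 1) := by
  rw [qInt_eq_sum hq1, Finset.sum_range_succ']
  have : 0 ≤ ∑ k ∈ Finset.range n, q ^ (k + 1) := Finset.sum_nonneg fun k _ => by positivity
  simpa using this

/-- One factor `[n]_q ≥ 1` is dropped and `q^n / [n]_q ≤ 1 / n` is used on the rest. The lost power
is why summability requires `Re s > 2`. -/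
lemma norm_qZetaTerm_succ_le {q : ℝ} (hq0 : 0 < q) (hq1 : q < 1) {s : ℂ} (hs : 1 ≤ s.re) (n : ℕ) :
    ‖qZetaTerm q s (n + 1)‖ ≤ 1 / ((n + 1 : ℕ) : ℝ) ^ (s.re - 1) := by
  have h1 := one_le_qInt_succ hq0 hq1 n
  have hI : 0 < qInt q (n + 1) := by linarith
  have hn : (0 : ℝ) < (n + 1 : ℕ) := by positivity
  have hre : (((n + 1 : ℕ) : ℂ) * (s - 1)).re = ((n + 1 : ℕ) : ℝ) * (s.re - 1) := by
    rw [← Complex.ofReal_natCast, Complex.re_ofReal_mul]; simp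
  rw [qZetaTerm, norm_div, norm_ofReal_cpow hq0, norm_ofReal_cpow hI, hre, Real.rpow_mul hq0.le,
    Real.rpow_natCast]
  calc (q ^ (n + 1)) ^ (s.re - 1) / qInt q (n + 1) ^ s.re
      ≤ (q ^ (n + 1)) ^ (s.re - 1) / qInt q (n + 1) ^ (s.re - 1) := by
        gcongr
        linarith
    _ = (q ^ (n + 1) / qInt q (n + 1)) ^ (s.re - 1) := by
        rw [Real.div_rpow (by positivity) hI.le]
    _ ≤ (1 / ((n + 1 : ℕ) : ℝ)) ^ (s.re - 1) := by
        refine Real.rpow_le_rpow (by positivity) ?_ (by linarith)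
        rw [div_le_div_iff₀ hI hn, one_mul, mul_comm]
        exact mul_pow_le_qInt hq0 hq1 (n + 1)
    _ = _ := by rw [Real.div_rpow zero_le_one hn.le, Real.one_rpow]

lemma tendsto_qZetaTerm_succ (s : ℂ) (n : ℕ) :
    Tendsto (fun q : ℝ => qZetaTerm q s (n + 1)) (𝓝[<] 1) (𝓝 (1 / ((n : ℂ) + 1) ^ s)) := by
  have hnum : Tendsto (fun q : ℝ => (q : ℂ) ^ (((n + 1 : ℕ) : ℂ) * (s - 1))) (𝓝[<] 1) (𝓝 1) := by
    have h : ContinuousAt (fun q : ℝ => (q : ℂ) ^ (((n + 1 : ℕ) : ℂ) * (s - 1))) 1 :=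
      Complex.continuous_ofReal.continuousAt.cpow continuousAt_const (by simp)
    simpa [ContinuousAt] using h.tendsto.mono_left nhdsWithin_le_nhds
  have hden : Tendsto (fun q : ℝ => (qInt q (n + 1) : ℂ) ^ s) (𝓝[<] 1)
      (𝓝 (((n : ℂ) + 1) ^ s)) := by
    have h := (Complex.continuous_ofReal.tendsto _).comp (tendsto_qInt (n + 1))
    have h2 := h.cpow (tendsto_const_nhds (x := s)) (by
      rw [Complex.ofReal_natCast]
      exact Complex.natCast_mem_slitPlane.2 n.succ_ne_zero)
    simpa using h2
  refine hnum.div hden ?_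
  rw [Ne, Complex.cpow_eq_zero_iff, not_and_or]
  left
  exact_mod_cast n.succ_ne_zero

lemma qZeta_eq_tsum {q : ℝ} (hq0 : 0 < q) (hq1 : q < 1) {s : ℂ} (hs : 1 < s.re) :
    qZeta q s = ∑' n : ℕ, qZetaTerm q s (n + 1) := by
  rw [qZeta_eq_toMeromorphicNFOn hq0 hq1]
  exact ((isQZetaContinuation_toMeromorphicNFOn hq0 hq1).hasSum s hs).tsum_eq.symm

lemma tendsto_qZeta_of_two_lt_re {s : ℂ} (hs : 2 < s.re) :
    Tendsto (fun q : ℝ => qZeta q s) (𝓝[<] 1) (𝓝 (riemannZeta s)) := by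
  have e1 : ∀ᶠ q : ℝ in 𝓝[<] 1, 0 < q ∧ q < 1 :=
    ((lt_mem_nhds one_pos).filter_mono nhdsWithin_le_nhds).and self_mem_nhdsWithin
  rw [zeta_eq_tsum_one_div_nat_add_one_cpow (by linarith)]
  have hsum : Summable (fun n : ℕ => 1 / ((n + 1 : ℕ) : ℝ) ^ (s.re - 1)) :=
    (summable_nat_add_iff 1).2 (Real.summable_one_div_nat_rpow.2 (by linarith))
  refine (tendsto_tsum_of_dominated_convergence hsum (tendsto_qZetaTerm_succ s)
    (e1.mono fun q hq n => norm_qZetaTerm_succ_le hq.1 hq.2 (by linarith) n)).congr' ?_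
  exact e1.mono fun q hq => (qZeta_eq_tsum hq.1 hq.2 (by linarith)).symm

/-- **Jensen's formula** `(s - 1) ζ(s) = (π / 2) ∫ (1 / 2 + i y) ^ (1 - s) / cosh² (π y) dy`. -/
lemma criticalIntegral_div_eq_riemannZeta {s : ℂ} (hs : s ≠ 1) :
    criticalIntegral s / (s - 1) = riemannZeta s := by
  have hf : AnalyticOnNhd ℂ (fun s => criticalIntegral s / (s - 1)) {1}ᶜ := fun w hw =>
    (differentiable_criticalIntegral.analyticAt w).div (by fun_prop) (sub_ne_zero.2 hw)
  have hg : AnalyticOnNhd ℂ riemannZeta {1}ᶜ :=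
    DifferentiableOn.analyticOnNhd
      (fun w hw => (differentiableAt_riemannZeta hw).differentiableWithinAt) isOpen_compl_singleton
  refine hf.eqOn_of_preconnected_of_eventuallyEq hg
    (isConnected_compl_singleton_of_one_lt_rank (by simp) 1).isPreconnected (z₀ := 3)
    (by simp) ?_ hs
  have h3 : ∀ᶠ w : ℂ in 𝓝 3, 2 < w.re :=
    Complex.continuous_re.continuousAt.eventually_const_lt (by norm_num)
  filter_upwards [h3] with w hw
  have hw1 : w ≠ 1 := by
    rintro rfl
    norm_num at hw
  -- Both functions are limits of the same `ζ_q(w)` near `3`.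
  exact tendsto_nhds_unique (tendsto_qZeta_criticalIntegral hw1) (tendsto_qZeta_of_two_lt_re hw)

end CriticalLine

theorem theorem2 :
    -- for `0 < q < 1` the meromorphic continuation defining `qZeta q` exists and is unique
    (∀ q : ℝ, 0 < q → q < 1 → ∃! F : ℂ → ℂ, IsQZetaContinuation q F) ∧
    -- for `s ≠ 1` the point `s` is not a pole of `qZeta q` once `q < 1` is close to `1`,
    -- and the limit is the value of the Riemann zeta function
    (∀ s : ℂ, s ≠ 1 →
      (∀ᶠ q : ℝ in 𝓝[<] 1, AnalyticAt ℂ (qZeta q) s) ∧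
      Tendsto (fun q : ℝ => qZeta q s) (𝓝[<] 1) (𝓝 (riemannZeta s))) := by
  refine ⟨fun q hq0 hq1 => ⟨_, isQZetaContinuation_toMeromorphicNFOn hq0 hq1, fun G hG =>
    hG.unique (isQZetaContinuation_toMeromorphicNFOn hq0 hq1)⟩, fun s hs =>
    ⟨(eventually_qZeta_eventuallyEq hs).mono fun q hq => hq.1, ?_⟩⟩
  rw [← criticalIntegral_div_eq_riemannZeta hs]
  exact tendsto_qZeta_criticalIntegral hs
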